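/- Let $d\ge 3$ and let $G$ be a graph on the vertex set $[d]=\{1,\dots,d\}$ without loops or multiple edges. **Definitions.** Let $\pi=a_1a_2\cdots a_d$ be a permutation of $[d]$. For each $k$ let $\ell(k)$ be the largest length (number of edges) of a path $a_{i_1},\dots,a_{i_p}=a_k$ in $G$ with $i_1<i_2<\cdots<i_p=k$. An integer $k\in\{0,\dots,d-1\}$ is a *cut* of $\pi$ if $k=0$, or $\ell(k)<\ell(k+1)$, or $\ell(k)=\ell(k+1)$ and $a_k<a_{k+1}$. The cuts divide $\pi$ into consecutive blocks (each cut $k$ starts a new block at $a_{k+1}$); the *short $G$-sequence* of $\pi$ is the sequence $D_1,\dots,D_k$ of these blocks with the last block omitted. Let $\beta(\pi)=\{D_1,\;D_1\cup D_2,\;\dots,\;D_1\cup\cdots\cup D_k\}$. The *truncated Boolean algebra* on $n$ elements is the set of all subsets of an $n$-element set other than $\emptyset$ and the whole set, ordered by inclusion; the *order complex* of a poset is the simplicial complex of its finite chains (including the empty chain). The *coloring complex* $\Delta_G$ consists of all chains $F$ of the truncated Boolean algebra on $[d]$ that contain $\beta(\pi)$ for no permutation $\pi$ of $[d]$. (Equivalently,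 its face ring is the face ring of the order complex of the truncated Boolean algebra modulo the ideal generated by the monomials $\prod_{S\in\beta(\pi)}x_S$.) For an edge $e=ij$ of $G$, an *$e$-permutation* is an arrangement $b_1b_2\cdots b_{d-1}$ of the $d-1$ letters in $([d]\setminus\{i,j\})\cup\{e\}$. It determines the chain $S_1\subset\cdots\subset S_{d-2}$ in which $S_m$ is the set of all vertices occurring in $b_1,\dots,b_m$ (where the letter $e$ stands for both $i$ and $j$). The *edge-sphere* (or $e$-sphere) $\Sigma_e$ is the simplicial complex generated by all these chains. **Theorem.** 1. For each edge $e$ of $G$, distinct $e$-permutations determine distinct chains, so that exactly $(d-1)!$ chains correspond to $e$. The facets of $\Delta_G$ are precisely the chains that correspond in this way to the edges of $G$, and the sets of facets that correspond to two distinct edges are disjoint. For each edge $e$, the edge-sphere $\Sigma_e$ is a $(d-3)$-sphere (its geometric realization is homeomorphic to the unit sphere of $\mathbb{R}^{d-2}$), and it is isomorphic to the order complex of the truncated Boolean algebra on $d-1$ elements, that is, to the first barycentric subdivision of the boundary of a $(d-2)$-simplex. If $G$ has at least one edge, then $\Delta_G$ has dimension $d-3$; if $G$ has no edges, then $\Delta_G$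 is the empty complex (it has no faces at all, not even the empty face). 2. If $e$ and $f$ are two distinct edges of $G$, then $\Sigma_e\cap\Sigma_f$ is a $(d-4)$-sphere (its geometric realization is homeomorphic to the unit sphere of $\mathbb{R}^{d-3}$, which is empty if $d=3$), and it is isomorphic to the order complex of the truncated Boolean algebra on $d-2$ elements. Moreover, if $f=ij$, then $\Sigma_e\cap\Sigma_f$ separates $\Sigma_e$ into two halves: $|\Sigma_e|\setminus|\Sigma_e\cap\Sigma_f|$ has exactly two connected components, one of which contains all vertices $S$ of $\Sigma_e$ with $i\in S$ and $j\notin S$, while the other contains all vertices $S$ of $\Sigma_e$ with $j\in S$ and $i\notin S$. -/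

import Mathlib

/-! Simplicial complexes are modelled as down-closed families `LowerSet (Finset V)` of finite sets
of vertices.  In contrast to `PreAbstractSimplicialComplex`, the empty set may be a face; so the
complex `⊥` with no face at all is different from the complex whose only face is `∅`. -/

/-- The order complex of a subset `P` of an ordered type: its faces are the finite chains of `P`. -/
def orderComplex {α : Type*} [LE α] (P : Set α) : LowerSet (Finset α) where
  carrier := {F | (F : Set α) ⊆ P ∧ IsChain (· ≤ ·) (F : Set α)}
  lower' := fun _ _ hba ha =>
    ⟨(Finset.coe_subset.2 hba).trans ha.1, ha.2.mono (Finset.coe_subset.2 hba)⟩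

/-- The truncated Boolean algebra on `n` atoms: all subsets of an `n`-element set except the empty
set and the whole set, ordered by inclusion. -/
def truncatedBoolean (n : ℕ) : Set (Finset (Fin n)) :=
  {S | S ≠ ∅ ∧ S ≠ Finset.univ}

/-- The boundary of the simplex with `n` vertices (an `(n - 1)`-dimensional simplex). -/
def simplexBoundary (n : ℕ) : LowerSet (Finset (Fin n)) where
  carrier := {F | F ≠ Finset.univ}
  lower' := fun _ _ hba ha hb => ha (Finset.univ_subset_iff.1 (hb ▸ hba))

/-- The first barycentric subdivision: the order complex of the poset of nonempty faces. -/
def barycentricSubdivision {V : Type*} (K : LowerSet (Finset V)) :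
    LowerSet (Finset (Finset V)) :=
  orderComplex {F : Finset V | F ∈ K ∧ F ≠ ∅}

/-- The vertices of a simplicial complex. -/
def complexVertices {V : Type*} (K : LowerSet (Finset V)) : Set V :=
  {v | {v} ∈ K}

/-- Isomorphism of simplicial complexes: a bijection between the sets of vertices such that a set
of vertices is a face if and only if its image is a face. -/
def ComplexIso {V W : Type*} (K : LowerSet (Finset V)) (L : LowerSet (Finset W)) : Prop :=
  ∃ φ : complexVertices K ≃ complexVertices L, ∀ F : Finset (complexVertices K),
    F.map (Function.Embedding.subtype _) ∈ K ↔
      (F.map φ.toEmbedding).map (Function.Embedding.subtype _) ∈ L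

/-- The facets (faces maximal under inclusion) of a simplicial complex. -/
def complexFacets {V : Type*} (K : LowerSet (Finset V)) : Set (Finset V) :=
  {F | Maximal (· ∈ K) F}

/-- `K` has dimension `n`: the largest value of `|F| - 1` over all faces `F` of `K` is `n`. -/
def HasComplexDim {V : Type*} (K : LowerSet (Finset V)) (n : ℤ) : Prop :=
  IsGreatest {m : ℤ | ∃ F ∈ K, m = (F.card : ℤ) - 1} n

/-- The geometric realization of a complex on a finite vertex type: the points of the standard
simplex (in barycentric coordinates) whose support is a face. -/
def geometricRealization {V : Type*} [Fintype V] (K : LowerSet (Finset V)) : Set (V → ℝ) :=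
  {x | x ∈ stdSimplex ℝ V ∧ ∃ F ∈ K, ∀ v, v ∈ F ↔ x v ≠ 0}

/-- The complex is an `n`-sphere, where `n + 1 = m`: its realization is homeomorphic to the unit
sphere of `ℝ^m`. -/
def IsComplexSphere {V : Type*} [Fintype V] (K : LowerSet (Finset V)) (m : ℕ) : Prop :=
  Nonempty (geometricRealization K ≃ₜ Metric.sphere (0 : EuclideanSpace ℝ (Fin m)) 1)

/-- Let `π = a_0 a_1 ⋯ a_{d-1}` be a permutation, `a_p = π p`.  This is the length (number of steps)
of the longest path of `G` that ends in `a_k` and runs through letters of `π` at increasing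
positions. -/
noncomputable def pathLength {d : ℕ} (G : SimpleGraph (Fin d)) (π : Equiv.Perm (Fin d))
    (k : Fin d) : ℕ :=
  sSup {n : ℕ | ∃ p : Fin (n + 1) → Fin d, StrictMono p ∧ p (Fin.last n) = k ∧
    ∀ t : Fin n, G.Adj (π (p t.castSucc)) (π (p t.succ))}

/-- Since `0` is always a cut, only the nonzero cuts are needed below.  The number `c` with
`0 < c < d` is a cut in `π` when, for the letters `a`, `b` of `π` immediately before and after the
gap number `c` (that is, the `c`-th and the `(c+1)`-st letter), the path length of `a` is smaller
than that of `b`, or they are equal and `a < b`. -/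
def IsNonzeroCut {d : ℕ} (G : SimpleGraph (Fin d)) (π : Equiv.Perm (Fin d)) (c : ℕ) : Prop :=
  ∃ p q : Fin d, (p : ℕ) + 1 = c ∧ (q : ℕ) = c ∧
    (pathLength G π p < pathLength G π q ∨
      (pathLength G π p = pathLength G π q ∧ π p < π q))

/-- The set of the first `c` letters of `π`. -/
def initialLetters {d : ℕ} (π : Equiv.Perm (Fin d)) (c : ℕ) : Finset (Fin d) :=
  (Finset.univ.filter fun p : Fin d => (p : ℕ) < c).image π

/-- The `G`-sequence of `π` is the sequence of blocks of letters of `π` between consecutive cuts,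
and the short `G`-sequence omits the last block.  This is the set of the partial unions
`D_1, D_1 ∪ D_2, …, D_1 ∪ ⋯ ∪ D_k` of the short `G`-sequence `D_1, …, D_k`; each of these unions
consists of the letters before a nonzero cut.  It is the set of indices of the variables that
occur in the basic coloring monomial of `π`. -/
def basicColoringSets {d : ℕ} (G : SimpleGraph (Fin d)) (π : Equiv.Perm (Fin d)) :
    Set (Finset (Fin d)) :=
  {S | ∃ c : ℕ, IsNonzeroCut G π c ∧ S = initialLetters π c}

/-- The coloring complex of `G`: the faces are the chains of the truncated Boolean algebra whose
(square-free) monomial is not divisible by a basic coloring monomial. -/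
def coloringComplex {d : ℕ} (G : SimpleGraph (Fin d)) : LowerSet (Finset (Finset (Fin d))) where
  carrier := {F | F ∈ orderComplex (truncatedBoolean d) ∧
    ∀ π : Equiv.Perm (Fin d), ¬ basicColoringSets G π ⊆ (F : Set (Finset (Fin d)))}
  lower' := fun _ _ hba ha => ⟨(orderComplex (truncatedBoolean d)).lower hba ha.1,
    fun π h => ha.2 π (h.trans (Finset.coe_subset.2 hba))⟩

/-- The letters for an edge `e`: the vertices not on `e`, and one letter (`none`) for `e`. -/
abbrev EdgeLetter {d : ℕ} (e : Sym2 (Fin d)) : Type := Option {v : Fin d // v ∉ e}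

/-- The set of vertices that a letter stands for: `{v}` or the two endpoints of `e`. -/
def edgeLetterSet {d : ℕ} (e : Sym2 (Fin d)) : EdgeLetter e → Finset (Fin d)
  | none => e.toFinset
  | some v => {v.1}

/-- An `e`-permutation: an arrangement of the `d - 1` letters for `e` in a row. -/
abbrev EdgePermutation {d : ℕ} (e : Sym2 (Fin d)) : Type := Fin (d - 1) ≃ EdgeLetter e

/-- The chain `S_1 ⊂ ⋯ ⊂ S_{d-2}` of an `e`-permutation, where `S_m` consists of all vertices
occurring in the first `m` letters. -/
def edgeChain {d : ℕ} (e : Sym2 (Fin d)) (σ : EdgePermutation e) : Finset (Finset (Fin d)) :=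
  (Finset.Icc 1 (d - 2)).image fun m =>
    (Finset.univ.filter fun k : Fin (d - 1) => (k : ℕ) < m).biUnion fun k => edgeLetterSet e (σ k)

/-- The sets of vertices that correspond to the edge `e`. -/
def edgeFacets {d : ℕ} (e : Sym2 (Fin d)) : Set (Finset (Finset (Fin d))) :=
  Set.range (edgeChain e)

/-- The edge-sphere of `e`: the complex generated by the chains of the `e`-permutations. -/
def edgeSphere {d : ℕ} (e : Sym2 (Fin d)) : LowerSet (Finset (Finset (Fin d))) :=
  lowerClosure (edgeFacets e)

/-- The part of the realization of the complex `K` that is left after the realization of the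
subcomplex `L` has been removed. -/
def realizationDiff {V : Type*} [Fintype V] (K L : LowerSet (Finset V)) : Set (V → ℝ) :=
  geometricRealization K \ geometricRealization L

/-- The subcomplex `L` separates the complex `K` into two parts, that is, `|K| \ |L|` has exactly
two connected components, one of which contains all vertices of `K` in `P` while the other one
contains all vertices of `K` in `Q`. -/
def SeparatesComplex {V : Type*} [Fintype V] [DecidableEq V] (K L : LowerSet (Finset V))
    (P Q : Set V) : Prop :=
  ∃ A B : Set (V → ℝ), A ≠ B ∧
    connectedComponentIn (realizationDiff K L) '' realizationDiff K L = {A, B} ∧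
    (∀ v ∈ complexVertices K, v ∈ P → Pi.single v (1 : ℝ) ∈ A) ∧
    (∀ v ∈ complexVertices K, v ∈ Q → Pi.single v (1 : ℝ) ∈ B)

/-! ### The realization of the order complex of a truncated Boolean algebra -/

/-! Combinatorics: a chain is a face of the coloring complex exactly when some edge `uv` is
separated by none of its sets (`mem_coloringComplex`). Path length rises strictly from the earlier
end of an edge to the later one, so every permutation has a cut between them. Conversely, if a chain
separates every edge, sorting the vertices by block, then by decreasing path length, then by
decreasing label gives a permutation whose cuts all come from the chain.

Hence the coloring complex is the union over the edges `e` of the order complexes of the proper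
nonempty sets that do not split `e`. These are the edge-spheres (`edgeSphere_eq`). Such sets are the
unions of fibres of a contraction onto `d - 1` points; for two edges, contract twice
(`exists_collapse_two`). Counting sets in chains gives facets, disjointness and dimension.

Topology: a point `x` of the realization yields the function `∑ x_S 1_S` on the ground set, and
`x_T` is recovered as the positive part of `min_T - max_{Tᶜ}`. The realization is thus the space of
nonconstant functions on the fibres modulo translation and positive scaling, which is a sphere
(`isComplexSphere_saturatedSets`). The equation `z i = z j` cuts it into two images of convex sets
(`separatesComplex_saturatedSets`). -/

theorem mem_geometricRealization_orderComplex {α : Type*} [Fintype α] [LE α] {P : Set α}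
    {x : α → ℝ} : x ∈ geometricRealization (orderComplex P) ↔
      (∀ S, 0 ≤ x S) ∧ ∑ S, x S = 1 ∧ (∀ S, x S ≠ 0 → S ∈ P) ∧
        ∀ S T, x S ≠ 0 → x T ≠ 0 → S ≠ T → S ≤ T ∨ T ≤ S := by
  classical
  constructor
  · rintro ⟨⟨h0, h1⟩, F, ⟨hP, hF⟩, hx⟩
    exact ⟨h0, h1, fun S hS => hP ((hx S).2 hS),
      fun S T hS hT hne => hF ((hx S).2 hS) ((hx T).2 hT) hne⟩
  · rintro ⟨h0, h1, hP, hF⟩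
    refine ⟨⟨h0, h1⟩, Finset.univ.filter (fun S => x S ≠ 0), ⟨?_, ?_⟩, by simp⟩
    · intro S hS
      exact hP S (by simpa using hS)
    · intro S hS T hT hne
      exact hF S T (by simpa using hS) (by simpa using hT) hne

/-- The function `∑ x_S 1_S` on the ground set. -/
def levelSum {n : ℕ} (x : Finset (Fin n) → ℝ) (v : Fin n) : ℝ :=
  ∑ S, if v ∈ S then x S else 0

section LevelSum

variable {n : ℕ} {x : Finset (Fin n) → ℝ}

theorem continuous_levelSum (v : Fin n) :
    Continuous fun x : Finset (Fin n) → ℝ => levelSum x v := by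
  unfold levelSum
  refine continuous_finsetSum _ fun S _ => ?_
  split_ifs <;> fun_prop

theorem levelSum_sub (x : Finset (Fin n) → ℝ) (v w : Fin n) : levelSum x v - levelSum x w =
    ∑ S, ((if v ∈ S then x S else 0) - if w ∈ S then x S else 0) := by
  rw [levelSum, levelSum, Finset.sum_sub_distrib]

theorem levelSum_single (S : Finset (Fin n)) (v : Fin n) :
    levelSum (Pi.single S (1 : ℝ)) v = if v ∈ S then 1 else 0 := by
  rw [levelSum, Finset.sum_eq_single S]
  · simp
  · intro T _ hT
    simp [hT]
  · simp

/-- No term of the difference is negative: a set of the support containing `w` is not inside `T`, so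
it contains `T` and hence `v`. The term of `T` alone contributes `x T`. -/
theorem le_levelSum_sub (hx : x ∈ geometricRealization (orderComplex (truncatedBoolean n)))
    {T : Finset (Fin n)} (hT : x T ≠ 0) {v w : Fin n} (hv : v ∈ T) (hw : w ∉ T) :
    x T ≤ levelSum x v - levelSum x w := by
  obtain ⟨h0, -, -, hc⟩ := mem_geometricRealization_orderComplex.1 hx
  rw [levelSum_sub]
  have key : ∀ S ∈ Finset.univ,
      0 ≤ (if v ∈ S then x S else 0) - if w ∈ S then x S else 0 := by
    intro S _
    have := h0 S
    by_cases hS : x S = 0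
    · simp [hS]
    by_cases hwS : w ∈ S
    · have hvS : v ∈ S := by
        rcases hc S T hS hT (fun h => hw (h ▸ hwS)) with h | h
        · exact absurd (h hwS) hw
        · exact h hv
      simp [hwS, hvS]
    · split_ifs <;> simp [this]
  simpa [hv, hw] using Finset.single_le_sum key (Finset.mem_univ T)

/-- Only `T` can contribute positively: a set of the support that contains `v` but not `w` is forced
by `le_levelSum_sub` to coincide with `T`. -/
theorem levelSum_sub_le (hx : x ∈ geometricRealization (orderComplex (truncatedBoolean n)))
    {T : Finset (Fin n)} {v w : Fin n}
    (hv : ∀ u ∈ T, levelSum x v ≤ levelSum x u) (hw : ∀ u ∉ T, levelSum x u ≤ levelSum x w) :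
    levelSum x v - levelSum x w ≤ x T := by
  obtain ⟨h0, -, -, hc⟩ := mem_geometricRealization_orderComplex.1 hx
  rw [levelSum_sub]
  have key : ∀ S ∈ Finset.univ, ((if v ∈ S then x S else 0) - if w ∈ S then x S else 0) ≤
      if S = T then x T else 0 := by
    intro S _
    have h0S := h0 S
    by_cases hST : S = T
    · subst hST
      rw [if_pos rfl]
      split_ifs <;> linarith
    rw [if_neg hST]
    by_cases hS : x S = 0
    · simp [hS]
    have hpos : 0 < x S := lt_of_le_of_ne h0S (Ne.symm hS)
    by_cases hvS : v ∈ S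
    · by_cases hwS : w ∈ S
      · simp [hvS, hwS]
      · exfalso
        apply hST
        ext u
        constructor
        · intro hu
          by_contra huT
          have := le_levelSum_sub hx hS hu hwS
          linarith [hw u huT]
        · intro hu
          by_contra huS
          have := le_levelSum_sub hx hS hvS huS
          linarith [hv u hu]
    · rw [if_neg hvS]
      split_ifs <;> linarith
  exact (Finset.sum_le_sum key).trans (by simp)

theorem levelSum_eq_iff (hx : x ∈ geometricRealization (orderComplex (truncatedBoolean n)))
    {u v : Fin n} : levelSum x u = levelSum x v ↔ ∀ S, x S ≠ 0 → (u ∈ S ↔ v ∈ S) := by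
  obtain ⟨h0, -, -, hc⟩ := mem_geometricRealization_orderComplex.1 hx
  constructor
  · intro h S hS
    have hpos : 0 < x S := lt_of_le_of_ne (h0 S) (Ne.symm hS)
    constructor
    · intro hu
      by_contra hv
      linarith [le_levelSum_sub hx hS hu hv]
    · intro hv
      by_contra hu
      linarith [le_levelSum_sub hx hS hv hu]
  · intro h
    refine Finset.sum_congr rfl fun S _ => ?_
    by_cases hS : x S = 0
    · simp [hS]
    · simp [h S hS]

/-- The weight of `T` in the representation of `y` by a chain of sets. -/
noncomputable def gapWeight (y : Fin n → ℝ) (T : Finset (Fin n)) : ℝ :=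
  if h : T.Nonempty ∧ Tᶜ.Nonempty then max 0 (T.inf' h.1 y - Tᶜ.sup' h.2 y) else 0

theorem continuous_gapWeight : Continuous (gapWeight (n := n)) := by
  refine continuous_pi fun T => ?_
  unfold gapWeight
  by_cases h : T.Nonempty ∧ Tᶜ.Nonempty
  · simp only [h, dite_true, and_self]
    refine continuous_const.max (Continuous.sub ?_ ?_)
    · exact Continuous.finset_inf'_apply _ fun i _ => continuous_apply i
    · exact Continuous.finset_sup'_apply _ fun i _ => continuous_apply i
  · simp only [h, dite_false]
    exact continuous_const

theorem gapWeight_levelSum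
    (hx : x ∈ geometricRealization (orderComplex (truncatedBoolean n))) {a b : ℝ} (hb : 0 < b) :
    gapWeight (fun v => b * levelSum x v + a) = fun T => b * x T := by
  obtain ⟨h0, -, hP, hc⟩ := mem_geometricRealization_orderComplex.1 hx
  ext T
  unfold gapWeight
  split_ifs with h
  · obtain ⟨v, hvT, hv⟩ := Finset.exists_mem_eq_inf' h.1 (fun v => b * levelSum x v + a)
    obtain ⟨w, hwT, hw⟩ := Finset.exists_mem_eq_sup' h.2 (fun v => b * levelSum x v + a)
    rw [hv, hw]
    rw [Finset.mem_compl] at hwT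
    have hv' : ∀ u ∈ T, levelSum x v ≤ levelSum x u := by
      intro u hu
      have := Finset.inf'_le (fun v => b * levelSum x v + a) hu
      rw [hv] at this
      exact le_of_mul_le_mul_left (by linarith) hb
    have hw' : ∀ u ∉ T, levelSum x u ≤ levelSum x w := by
      intro u hu
      have := Finset.le_sup' (fun v => b * levelSum x v + a) (Finset.mem_compl.2 hu)
      rw [hw] at this
      exact le_of_mul_le_mul_left (by linarith) hb
    have h1 := levelSum_sub_le hx hv' hw'
    have e : b * levelSum x v + a - (b * levelSum x w + a) =
      b * (levelSum x v - levelSum x w) := by ring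
    rw [e]
    -- Off the support the gap is nonpositive and truncated to `0`; on it the two bounds pinch.
    by_cases hT : x T = 0
    · rw [hT] at h1 ⊢
      rw [mul_zero]
      exact max_eq_left (mul_nonpos_of_nonneg_of_nonpos hb.le h1)
    · have h2 := le_levelSum_sub hx hT hvT hwT
      rw [le_antisymm h1 h2]
      exact max_eq_right (mul_nonneg hb.le (h0 T))
  · have : x T = 0 := by
      by_contra hT
      obtain ⟨h1, h2⟩ := hP T hT
      apply h
      refine ⟨Finset.nonempty_iff_ne_empty.2 h1, Finset.nonempty_iff_ne_empty.2 fun h3 => h2 ?_⟩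
      simpa using h3
    simp [this]

open MeasureTheory in
-- Layer-cake formula: the weight of `T` is the measure of the levels `t` in `[0, 1)` at which the
-- superlevel set `{v | t < y v}` equals `T`. Superlevel sets are nested; the attained values `1`
-- and `0` make them nonempty and proper.
theorem exists_levelSum_eq {y : Fin n → ℝ} (h0 : ∀ v, 0 ≤ y v) (h1 : ∀ v, y v ≤ 1)
    (h0' : ∃ v, y v = 0) (h1' : ∃ v, y v = 1) :
    ∃ x ∈ geometricRealization (orderComplex (truncatedBoolean n)), levelSum x = y := by
  classical
  let A : Finset (Fin n) → Set ℝ := fun T =>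
    Set.Ico 0 1 ∩ {t | Finset.univ.filter (fun v => t < y v) = T}
  have hA : ∀ T, MeasurableSet (A T) := by
    intro T
    refine measurableSet_Ico.inter ?_
    have : {t : ℝ | Finset.univ.filter (fun v => t < y v) = T} =
        ⋂ v, {t | t < y v ↔ v ∈ T} := by
      ext t
      simp [Finset.ext_iff]
    rw [this]
    refine MeasurableSet.iInter fun v => ?_
    by_cases hv : v ∈ T
    · simp only [hv, iff_true]
      exact measurableSet_Iio
    · simp only [hv, iff_false, not_lt]
      exact measurableSet_Ici
  have hsum : ∀ s : Finset (Finset (Fin n)),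
      ∑ T ∈ s, volume.real (A T) = volume.real (⋃ T ∈ s, A T) := by
    intro s
    refine (measureReal_biUnion_finset ?_ (fun T _ => hA T) ?_).symm
    · intro S _ T _ hST
      refine Set.disjoint_left.2 fun t hS hT => hST ?_
      exact hS.2.symm.trans hT.2
    · intro T _
      exact ((measure_mono Set.inter_subset_left).trans_lt (by simp)).ne
  have hne : ∀ T, volume.real (A T) ≠ 0 → ∃ t, t ∈ A T := by
    intro T hT
    by_contra! h
    exact hT (by rw [Set.eq_empty_of_forall_notMem h]; simp)
  refine ⟨fun T => volume.real (A T), mem_geometricRealization_orderComplex.2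
    ⟨fun _ => measureReal_nonneg, ?_, ?_, ?_⟩, ?_⟩
  · rw [hsum]
    have : (⋃ T ∈ Finset.univ, A T) = Set.Ico (0 : ℝ) 1 := by
      ext t
      simp [A]
    rw [this]
    simp
  · intro T hT
    obtain ⟨t, ht, rfl⟩ := hne T hT
    obtain ⟨v, hv⟩ := h0'
    obtain ⟨w, hw⟩ := h1'
    constructor
    · intro h
      have : w ∈ Finset.univ.filter (fun v => t < y v) := by simp [hw, ht.2]
      rw [h] at this
      simp at this
    · intro h
      have : v ∈ Finset.univ.filter (fun v => t < y v) := by rw [h]; simp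
      simp only [Finset.mem_filter, hv] at this
      linarith [ht.1, this.2]
  · intro S T hS hT _
    obtain ⟨t, ht, rfl⟩ := hne S hS
    obtain ⟨s, hs, rfl⟩ := hne T hT
    rcases le_total t s with h | h
    · right
      intro v
      simp only [Finset.mem_filter]
      exact fun hv => ⟨hv.1, h.trans_lt hv.2⟩
    · left
      intro v
      simp only [Finset.mem_filter]
      exact fun hv => ⟨hv.1, h.trans_lt hv.2⟩
  · ext v
    rw [levelSum, ← Finset.sum_filter, hsum]
    have : (⋃ T ∈ Finset.univ.filter (fun T : Finset (Fin n) => v ∈ T), A T) =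
        Set.Ico (0 : ℝ) (y v) := by
      ext t
      simp only [Finset.mem_filter, Finset.mem_univ, true_and, Set.mem_iUnion, A, Set.mem_inter_iff,
        Set.mem_Ico, Set.mem_ofPred_eq, exists_prop]
      constructor
      · rintro ⟨T, hv, ht, rfl⟩
        exact ⟨ht.1, by simpa using hv⟩
      · rintro ⟨ht, htv⟩
        exact ⟨_, by simpa using htv, ⟨ht, htv.trans_le (h1 v)⟩, rfl⟩
    rw [this]
    simp [h0 v]

theorem exists_affine_levelSum_eq {z : Fin n → ℝ} {u v : Fin n} (huv : z u ≠ z v) :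
    ∃ x ∈ geometricRealization (orderComplex (truncatedBoolean n)), ∃ a b : ℝ, 0 < b ∧
      z = fun w => b * levelSum x w + a := by
  have : Nonempty (Fin n) := ⟨u⟩
  obtain ⟨p, hp⟩ := Finite.exists_min z
  obtain ⟨q, hq⟩ := Finite.exists_max z
  have hb : 0 < z q - z p := by
    rcases lt_or_gt_of_ne huv with h | h
    · linarith [hp u, hq v]
    · linarith [hp v, hq u]
  obtain ⟨x, hx, hxy⟩ := exists_levelSum_eq (y := fun w => (z w - z p) / (z q - z p))
    (fun w => div_nonneg (by linarith [hp w]) hb.le)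
    (fun w => (div_le_one hb).2 (by linarith [hq w])) ⟨p, by simp⟩ ⟨q, div_self hb.ne'⟩
  refine ⟨x, hx, z p, z q - z p, hb, ?_⟩
  ext w
  rw [hxy, mul_div_cancel₀ _ hb.ne']
  ring

/-- The point of the realization that represents `z` up to scaling and translation. -/
noncomputable def chainPoint (z : Fin n → ℝ) (T : Finset (Fin n)) : ℝ :=
  gapWeight z T / ∑ S, gapWeight z S

theorem chainPoint_levelSum
    (hx : x ∈ geometricRealization (orderComplex (truncatedBoolean n))) {a b : ℝ} (hb : 0 < b) :
    chainPoint (fun v => b * levelSum x v + a) = x := by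
  obtain ⟨-, h1, -, -⟩ := mem_geometricRealization_orderComplex.1 hx
  ext T
  rw [chainPoint, gapWeight_levelSum hx hb, ← Finset.mul_sum, h1, mul_one,
    mul_div_cancel_left₀ _ hb.ne']

theorem chainPoint_mem {z : Fin n → ℝ} {u v : Fin n} (huv : z u ≠ z v) :
    chainPoint z ∈ geometricRealization (orderComplex (truncatedBoolean n)) ∧
      ∃ a b : ℝ, 0 < b ∧ z = fun w => b * levelSum (chainPoint z) w + a := by
  obtain ⟨x, hx, a, b, hb, rfl⟩ := exists_affine_levelSum_eq huv
  rw [chainPoint_levelSum hx hb]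
  exact ⟨hx, a, b, hb, rfl⟩

theorem continuousOn_chainPoint :
    ContinuousOn (chainPoint (n := n)) {z | ∃ u v, z u ≠ z v} := by
  refine continuousOn_pi.2 fun T => ContinuousOn.div ?_ ?_ ?_
  · exact ((continuous_apply T).comp continuous_gapWeight).continuousOn
  · exact (continuous_finsetSum _ fun S _ =>
      (continuous_apply S).comp continuous_gapWeight).continuousOn
  · rintro z ⟨u, v, huv⟩ h
    -- Since division by zero gives `0`, a vanishing denominator would make the coordinates sum to
    -- `0` instead of `1`.
    have := (mem_geometricRealization_orderComplex.1 (chainPoint_mem huv).1).2.1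
    simp [chainPoint, h] at this

end LevelSum

/-! ### Saturated sets -/

/-- The nonempty proper subsets that are unions of fibres of `q`. -/
def saturatedSets {n : ℕ} {α : Type*} (q : Fin n → α) : Set (Finset (Fin n)) :=
  {S | S ∈ truncatedBoolean n ∧ ∀ u v, q u = q v → u ∈ S → v ∈ S}

theorem mem_geometricRealization_saturatedSets {n : ℕ} {α : Type*} {q : Fin n → α}
    {x : Finset (Fin n) → ℝ} :
    x ∈ geometricRealization (orderComplex (saturatedSets q)) ↔
      x ∈ geometricRealization (orderComplex (truncatedBoolean n)) ∧
        ∀ u v, q u = q v → levelSum x u = levelSum x v := by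
  constructor
  · intro h
    have h' := mem_geometricRealization_orderComplex.1 h
    have hx : x ∈ geometricRealization (orderComplex (truncatedBoolean n)) :=
      mem_geometricRealization_orderComplex.2
        ⟨h'.1, h'.2.1, fun S hS => (h'.2.2.1 S hS).1, h'.2.2.2⟩
    exact ⟨hx, fun u v huv => (levelSum_eq_iff hx).2 fun S hS =>
      ⟨(h'.2.2.1 S hS).2 u v huv, (h'.2.2.1 S hS).2 v u huv.symm⟩⟩
  · rintro ⟨hx, h⟩
    have h' := mem_geometricRealization_orderComplex.1 hx
    exact mem_geometricRealization_orderComplex.2 ⟨h'.1, h'.2.1, fun S hS =>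
      ⟨h'.2.2.1 S hS, fun u v huv => ((levelSum_eq_iff hx).1 (h u v huv) S hS).1⟩, h'.2.2.2⟩

/-- Each class of nonconstant functions on the fibres, modulo translation and positive scaling, has
one representative that vanishes on the fibre over `0` and has norm one. This gives a continuous
bijection from a compact space to a Hausdorff one. -/
theorem isComplexSphere_saturatedSets {n k : ℕ} {q : Fin n → Fin (k + 1)}
    (hq : Function.Surjective q) : IsComplexSphere (orderComplex (saturatedSets q)) k := by
  let c : EuclideanSpace ℝ (Fin k) → Fin n → ℝ := fun z v =>
    (Fin.cons 0 (fun i => z i) : Fin (k + 1) → ℝ) (q v)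
  have hc : Continuous c := by
    refine continuous_pi fun v => ?_
    simp only [c]
    generalize q v = p
    refine Fin.cases ?_ (fun i => ?_) p
    · simpa using continuous_const
    · simp only [Fin.cons_succ]
      fun_prop
  have hnc : ∀ z, z ≠ 0 → ∃ u v, c z u ≠ c z v := by
    intro z hz
    obtain ⟨i, hi⟩ : ∃ i, z i ≠ 0 := by
      by_contra! h
      exact hz (by ext i; simpa using h i)
    obtain ⟨u, hu⟩ := hq i.succ
    obtain ⟨v, hv⟩ := hq 0
    exact ⟨u, v, by simpa [c, hu, hv] using hi⟩
  have hS : ∀ z : Metric.sphere (0 : EuclideanSpace ℝ (Fin k)) 1, (z : _) ≠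
      (0 : EuclideanSpace ℝ (Fin k)) := fun z => ne_zero_of_mem_unit_sphere z
  have hmem : ∀ z, z ≠ 0 →
      chainPoint (c z) ∈ geometricRealization (orderComplex (saturatedSets q)) := by
    intro z hz
    obtain ⟨u, v, huv⟩ := hnc z hz
    obtain ⟨h1, a, b, hb, h2⟩ := chainPoint_mem huv
    refine mem_geometricRealization_saturatedSets.2 ⟨h1, fun s t hst => ?_⟩
    have h3 : c z s = c z t := by simp only [c, hst]
    rw [congrFun h2 s, congrFun h2 t] at h3
    have h3' : b * levelSum (chainPoint (c z)) s = b * levelSum (chainPoint (c z)) t := by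
      linarith
    exact mul_left_cancel₀ hb.ne' h3'
  let f : Metric.sphere (0 : EuclideanSpace ℝ (Fin k)) 1 →
      geometricRealization (orderComplex (saturatedSets q)) :=
    fun z => ⟨chainPoint (c z), hmem z (hS z)⟩
  have hf : Continuous f := by
    refine Continuous.subtype_mk ?_ _
    exact continuousOn_chainPoint.comp_continuous (hc.comp continuous_subtype_val)
      fun z => hnc z (hS z)
  have hbij : Function.Bijective f := by
    constructor
    · intro z w hzw
      have hzw' : chainPoint (c z) = chainPoint (c w) := congrArg Subtype.val hzw
      obtain ⟨u, v, huv⟩ := hnc z (hS z)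
      obtain ⟨-, a, b, hb, h2⟩ := chainPoint_mem huv
      obtain ⟨u', v', huv'⟩ := hnc w (hS w)
      obtain ⟨-, a', b', hb', h2'⟩ := chainPoint_mem huv'
      rw [← hzw'] at h2'
      obtain ⟨v₀, hv₀⟩ := hq 0
      have e1 := congrFun h2 v₀
      have e2 := congrFun h2' v₀
      simp only [c, hv₀, Fin.cons_zero] at e1 e2
      -- Both functions are positive affine images of one level function. Vanishing over `0` removes
      -- the translations; comparing norms then gives `b = b'`.
      have key : b' • (z : EuclideanSpace ℝ (Fin k)) = b • (w : EuclideanSpace ℝ (Fin k)) := by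
        ext i
        obtain ⟨vi, hvi⟩ := hq i.succ
        have e3 := congrFun h2 vi
        have e4 := congrFun h2' vi
        simp only [c, hvi, Fin.cons_succ] at e3 e4
        simp only [PiLp.smul_apply, smul_eq_mul]
        rw [e3, e4]
        linear_combination b' * (-e1) + b * e2
      have hn := congrArg norm key
      rw [norm_smul, norm_smul, norm_eq_of_mem_sphere z, norm_eq_of_mem_sphere w,
        Real.norm_of_nonneg hb.le, Real.norm_of_nonneg hb'.le, mul_one, mul_one] at hn
      rw [hn] at key
      exact Subtype.ext (smul_right_injective _ hb.ne' key)
    · rintro ⟨x, hx⟩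
      obtain ⟨hx', hq'⟩ := mem_geometricRealization_saturatedSets.1 hx
      obtain ⟨s, hs⟩ := hq.hasRightInverse
      let z : EuclideanSpace ℝ (Fin k) :=
        WithLp.toLp 2 fun i => levelSum x (s i.succ) - levelSum x (s 0)
      have hz : ∀ v, c z v = levelSum x v - levelSum x (s 0) := by
        intro v
        rw [hq' v (s (q v)) (hs (q v)).symm]
        simp only [c]
        generalize q v = p
        refine Fin.cases ?_ (fun i => ?_) p
        · simp
        · simp [z]
      have hz0 : z ≠ 0 := by
        intro h0
        -- A constant level function would force every set of the support to be the whole ground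
        -- set.
        have hconst : ∀ v, levelSum x v = levelSum x (s 0) := by
          intro v
          have := hz v
          have h0' : c z v = 0 := by
            rw [h0]
            simp only [c]
            generalize q v = p
            refine Fin.cases ?_ (fun i => ?_) p <;> simp
          linarith
        obtain ⟨-, h1, hP, -⟩ := mem_geometricRealization_orderComplex.1 hx'
        obtain ⟨T, -, hT⟩ : ∃ T ∈ Finset.univ, x T ≠ 0 :=
          Finset.exists_ne_zero_of_sum_ne_zero (by rw [h1]; exact one_ne_zero)
        obtain ⟨hT1, hT2⟩ := hP T hT
        obtain ⟨v, hv⟩ := Finset.nonempty_iff_ne_empty.2 hT1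
        apply hT2
        ext w
        simpa using ((levelSum_eq_iff hx').1 ((hconst v).trans (hconst w).symm) T hT).1 hv
      have hpos : 0 < ‖z‖ := norm_pos_iff.2 hz0
      refine ⟨⟨‖z‖⁻¹ • z, by simp [norm_smul, hpos.ne']⟩, Subtype.ext ?_⟩
      have : c (‖z‖⁻¹ • z) = fun v => ‖z‖⁻¹ * levelSum x v + -(‖z‖⁻¹ * levelSum x (s 0)) := by
        ext v
        have h1 : c (‖z‖⁻¹ • z) v = ‖z‖⁻¹ * c z v := by
          simp only [c]
          generalize q v = p
          refine Fin.cases ?_ (fun i => ?_) p <;> simp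
        rw [h1, hz]
        ring
      change chainPoint (c (‖z‖⁻¹ • z)) = x
      rw [this]
      exact chainPoint_levelSum hx' (inv_pos.2 hpos)
  exact ⟨(Continuous.homeoOfEquivCompactToT2 (f := Equiv.ofBijective f hbij) hf).symm⟩

/-- The open half is the image under `chainPoint` of a convex set of functions. -/
theorem isPreconnected_levelSum_lt {n : ℕ} {α : Type*} (q : Fin n → α) (i j : Fin n) :
    IsPreconnected {x | x ∈ geometricRealization (orderComplex (saturatedSets q)) ∧
      levelSum x j < levelSum x i} := by
  let C : Set (Fin n → ℝ) := {z | (∀ u v, q u = q v → z u = z v) ∧ z j < z i}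
  have hC : Convex ℝ C := by
    rintro z ⟨hz1, hz2⟩ w ⟨hw1, hw2⟩ a b ha hb hab
    refine ⟨fun u v huv => by simp [hz1 u v huv, hw1 u v huv], ?_⟩
    simp only [Pi.add_apply, Pi.smul_apply, smul_eq_mul]
    rcases ha.eq_or_lt with rfl | ha
    · have : b = 1 := by linarith
      subst this
      linarith
    · nlinarith
  have : {x | x ∈ geometricRealization (orderComplex (saturatedSets q)) ∧
      levelSum x j < levelSum x i} = chainPoint '' C := by
    ext x
    constructor
    · rintro ⟨hx, hlt⟩
      obtain ⟨hx1, hx2⟩ := mem_geometricRealization_saturatedSets.1 hx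
      refine ⟨levelSum x, ⟨hx2, hlt⟩, ?_⟩
      simpa using chainPoint_levelSum hx1 (a := 0) one_pos
    · rintro ⟨z, ⟨hz1, hz2⟩, rfl⟩
      obtain ⟨h1, a, b, hb, h2⟩ := chainPoint_mem hz2.ne
      refine ⟨mem_geometricRealization_saturatedSets.2 ⟨h1, fun u v huv => ?_⟩, ?_⟩
      · have := hz1 u v huv
        rw [congrFun h2 u, congrFun h2 v] at this
        exact mul_left_cancel₀ hb.ne' (add_right_cancel this)
      · rw [congrFun h2 i, congrFun h2 j] at hz2
        exact lt_of_mul_lt_mul_left (by linarith) hb.le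
  rw [this]
  exact hC.isPreconnected.image _
    (continuousOn_chainPoint.mono fun z hz => ⟨j, i, hz.2.ne⟩)

/-- Removing the subcomplex removes the locus where the levels of `i` and `j` agree. The two strict
inequalities define disjoint, relatively open, preconnected pieces, which are therefore the
components. -/
theorem separatesComplex_saturatedSets {n : ℕ} {α : Type*} {q : Fin n → α} {i j : Fin n}
    (hij : q i ≠ q j) :
    SeparatesComplex (orderComplex (saturatedSets q))
      (orderComplex (saturatedSets q ∩ {S | i ∈ S ↔ j ∈ S}))
      {S | i ∈ S ∧ j ∉ S} {S | j ∈ S ∧ i ∉ S} := by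
  classical
  set K := orderComplex (saturatedSets q)
  set L := orderComplex (saturatedSets q ∩ {S | i ∈ S ↔ j ∈ S})
  let H : Fin n → Fin n → Set (Finset (Fin n) → ℝ) := fun a b =>
    {x | x ∈ geometricRealization K ∧ levelSum x b < levelSum x a}
  have hdiff : realizationDiff K L = H i j ∪ H j i := by
    have hL : ∀ x, x ∈ geometricRealization L ↔
        x ∈ geometricRealization K ∧ levelSum x i = levelSum x j := by
      intro x
      constructor
      · intro hx
        have h := mem_geometricRealization_orderComplex.1 hx
        have hK : x ∈ geometricRealization K := mem_geometricRealization_orderComplex.2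
          ⟨h.1, h.2.1, fun S hS => (h.2.2.1 S hS).1, h.2.2.2⟩
        exact ⟨hK, (levelSum_eq_iff (mem_geometricRealization_saturatedSets.1 hK).1).2
          fun S hS => (h.2.2.1 S hS).2⟩
      · rintro ⟨hx, hxij⟩
        have h := mem_geometricRealization_orderComplex.1 hx
        exact mem_geometricRealization_orderComplex.2 ⟨h.1, h.2.1, fun S hS =>
          ⟨h.2.2.1 S hS, (levelSum_eq_iff (mem_geometricRealization_saturatedSets.1 hx).1).1
            hxij S hS⟩, h.2.2.2⟩
    ext x
    have := hL x
    have h2 : levelSum x i ≠ levelSum x j ↔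
      levelSum x j < levelSum x i ∨ levelSum x i < levelSum x j := by
      rw [ne_iff_lt_or_gt, or_comm]
    simp only [realizationDiff, Set.mem_sdiff, Set.mem_union, H, Set.mem_ofPred_eq]
    tauto
  have hvertex : ∀ a b : Fin n, ∀ S ∈ complexVertices K, a ∈ S → b ∉ S →
      Pi.single S (1 : ℝ) ∈ H a b := by
    intro a b S hS ha hb
    refine ⟨⟨single_mem_stdSimplex ℝ S, {S}, hS, fun T => ?_⟩, ?_⟩
    · rw [Finset.mem_singleton]
      by_cases h : T = S <;> simp [h]
    · rw [levelSum_single, levelSum_single, if_pos ha, if_neg hb]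
      exact one_pos
  have hnonempty : ∀ a b : Fin n, q a ≠ q b → (H a b).Nonempty := by
    intro a b hab
    have ha : a ∈ Finset.univ.filter fun v => q v = q a := by simp
    have hb : b ∉ Finset.univ.filter fun v => q v = q a := by simpa using hab.symm
    -- The fibre of `a` is itself saturated and misses `b`, so it is a vertex in this half.
    refine ⟨_, hvertex a b (Finset.univ.filter fun v => q v = q a) ⟨?_, by simp⟩ ha hb⟩
    intro S hS
    obtain rfl : S = Finset.univ.filter fun v => q v = q a := by simpa using hS
    refine ⟨⟨Finset.ne_empty_of_mem ha, fun h => hb (by rw [h]; exact Finset.mem_univ b)⟩, ?_⟩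
    intro u v huv hu
    simpa [← huv] using hu
  have hdisj : ∀ a b x, x ∈ H a b → x ∉ H b a := fun a b x h h' => lt_asymm h.2 h'.2
  have hopen : ∀ a b : Fin n, IsOpen {x : Finset (Fin n) → ℝ | levelSum x b < levelSum x a} :=
    fun a b => isOpen_lt (continuous_levelSum b) (continuous_levelSum a)
  have hcomp : ∀ a b, realizationDiff K L = H a b ∪ H b a → ∀ x ∈ H a b,
      connectedComponentIn (realizationDiff K L) x = H a b := by
    intro a b hab x hx
    have hxD : x ∈ realizationDiff K L := hab ▸ Or.inl hx
    have hsub := connectedComponentIn_subset (realizationDiff K L) x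
    refine Set.Subset.antisymm ?_ ?_
    · have h := isPreconnected_connectedComponentIn.subset_left_of_subset_union
        (s := connectedComponentIn (realizationDiff K L) x) (hopen a b) (hopen b a)
        (Set.disjoint_left.2 fun y (h : levelSum y b < levelSum y a)
          (h' : levelSum y a < levelSum y b) => lt_asymm h h')
        (fun y hy => by
          have := hsub hy
          rw [hab] at this
          exact this.imp And.right And.right)
        ⟨x, mem_connectedComponentIn hxD, hx.2⟩
      exact fun y hy => ⟨(hsub hy).1, h hy⟩
    · exact (isPreconnected_levelSum_lt q a b).subset_connectedComponentIn hx
        (hab ▸ Set.subset_union_left)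
  have hdiff' := hdiff.trans (Set.union_comm _ _)
  obtain ⟨x, hx⟩ := hnonempty i j hij
  obtain ⟨y, hy⟩ := hnonempty j i hij.symm
  refine ⟨H i j, H j i, fun h => hdisj i j x hx (h ▸ hx), ?_,
    fun S hS h => hvertex i j S hS h.1 h.2, fun S hS h => hvertex j i S hS h.1 h.2⟩
  ext A
  simp only [Set.mem_image, Set.mem_insert_iff, Set.mem_singleton_iff]
  constructor
  · rintro ⟨z, hz, rfl⟩
    rw [hdiff] at hz
    exact hz.imp (hcomp i j hdiff z) (hcomp j i hdiff' z)
  · rintro (rfl | rfl)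
    · exact ⟨x, hdiff ▸ Or.inl hx, hcomp i j hdiff x hx⟩
    · exact ⟨y, hdiff ▸ Or.inr hy, hcomp j i hdiff' y hy⟩

/-! ### Isomorphisms -/

/-- Image and preimage under `q` are mutually inverse and preserve inclusion. -/
theorem complexIso_saturatedSets {n m : ℕ} {q : Fin n → Fin m} (hq : Function.Surjective q) :
    ComplexIso (orderComplex (saturatedSets q)) (orderComplex (truncatedBoolean m)) := by
  classical
  have hvert : ∀ {β : Type} [LE β] (P : Set β) (v : β),
      v ∈ complexVertices (orderComplex P) ↔ v ∈ P := by
    intro β _ P v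
    constructor
    · intro h
      exact h.1 (by simp)
    · intro h
      exact ⟨by simpa using h, by simp⟩
  have hpre : ∀ S ∈ saturatedSets q, (Finset.univ.filter fun v => q v ∈ S.image q) = S := by
    intro S hS
    ext v
    simp only [Finset.mem_filter, Finset.mem_univ, true_and, Finset.mem_image]
    exact ⟨fun ⟨u, hu, huv⟩ => hS.2 u v huv hu, fun h => ⟨v, h, rfl⟩⟩
  have himg : ∀ T : Finset (Fin m), (Finset.univ.filter fun v => q v ∈ T).image q = T := by
    intro T
    ext p
    obtain ⟨v, rfl⟩ := hq p
    simp only [Finset.mem_image, Finset.mem_filter, Finset.mem_univ, true_and]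
    exact ⟨fun ⟨u, hu, huv⟩ => huv ▸ hu, fun h => ⟨v, h, rfl⟩⟩
  have hle : ∀ S ∈ saturatedSets q, ∀ T ∈ saturatedSets q,
      (S ≤ T ↔ S.image q ≤ T.image q) := by
    intro S hS T hT
    refine ⟨fun h => Finset.image_subset_image h, fun h => ?_⟩
    rw [← hpre S hS, ← hpre T hT]
    exact Finset.monotone_filter_right _ fun v _ hv => h hv
  let φ : complexVertices (orderComplex (saturatedSets q)) ≃
      complexVertices (orderComplex (truncatedBoolean m)) :=
    { toFun := fun S => ⟨S.1.image q, by
        have hS := (hvert _ _).1 S.2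
        refine (hvert _ _).2 ⟨?_, ?_⟩
        · intro h
          exact hS.1.1 (Finset.image_eq_empty.1 h)
        · intro h
          apply hS.1.2
          rw [← hpre _ hS, h]
          simp⟩
      invFun := fun T => ⟨Finset.univ.filter fun v => q v ∈ T.1, by
        have hT := (hvert _ _).1 T.2
        refine (hvert _ _).2 ⟨⟨?_, ?_⟩, ?_⟩
        · intro h
          apply hT.1
          rw [← himg T.1, h, Finset.image_empty]
        · intro h
          apply hT.2
          rw [← himg T.1, h, Finset.image_univ_of_surjective hq]
        · intro u v huv hu
          simpa [← huv] using hu⟩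
      left_inv := fun S => Subtype.ext (hpre _ ((hvert _ _).1 S.2))
      right_inv := fun T => Subtype.ext (himg T.1) }
  refine ⟨φ, fun F => ?_⟩
  constructor
  · rintro ⟨-, hF⟩
    constructor
    · intro T hT
      simp only [Finset.coe_map, Set.mem_image, Function.Embedding.subtype_apply] at hT
      obtain ⟨T, -, rfl⟩ := hT
      exact (hvert _ _).1 T.2
    · intro T hT T' hT' hne
      simp only [Finset.coe_map, Set.mem_image, Function.Embedding.subtype_apply,
        Equiv.toEmbedding_apply, exists_exists_and_eq_and] at hT hT'
      obtain ⟨S, hS, rfl⟩ := hT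
      obtain ⟨S', hS', rfl⟩ := hT'
      have := hF (x := S.1) (by simpa using hS) (y := S'.1) (by simpa using hS')
        (fun h => hne (by rw [Subtype.ext h]))
      change S.1 ≤ S'.1 ∨ S'.1 ≤ S.1 at this
      rwa [hle _ ((hvert _ _).1 S.2) _ ((hvert _ _).1 S'.2),
        hle _ ((hvert _ _).1 S'.2) _ ((hvert _ _).1 S.2)] at this
  · rintro ⟨-, hF⟩
    constructor
    · intro T hT
      simp only [Finset.coe_map, Set.mem_image, Function.Embedding.subtype_apply] at hT
      obtain ⟨T, -, rfl⟩ := hT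
      exact (hvert _ _).1 T.2
    · intro S hS S' hS' hne
      simp only [Finset.coe_map, Set.mem_image, Function.Embedding.subtype_apply] at hS hS'
      obtain ⟨S, hS, rfl⟩ := hS
      obtain ⟨S', hS', rfl⟩ := hS'
      have := hF (x := (φ S).1) (by simpa using hS) (y := (φ S').1) (by simpa using hS')
        (fun h => hne (by rw [φ.injective (Subtype.ext h)]))
      change S.1.image q ≤ S'.1.image q ∨ S'.1.image q ≤ S.1.image q at this
      rwa [← hle _ ((hvert _ _).1 S.2) _ ((hvert _ _).1 S'.2),
        ← hle _ ((hvert _ _).1 S'.2) _ ((hvert _ _).1 S.2)] at this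

/-! ### Chains of finite sets and orderings compatible with them -/

section ChainHeight

variable {V : Type*} [DecidableEq V]

/-- The number of sets of `F` that do not contain `v`. -/
def chainHeight (F : Finset (Finset V)) (v : V) : ℕ :=
  (F.filter fun S => v ∉ S).card

/-- A set of the chain that misses `u` lies inside `S` and so misses `v` too; `S` itself misses only
`v`. -/
theorem chainHeight_lt {F : Finset (Finset V)}
    (hF : IsChain (· ≤ ·) (F : Set (Finset V))) {S : Finset V} (hS : S ∈ F) {u v : V}
    (hu : u ∈ S) (hv : v ∉ S) : chainHeight F u < chainHeight F v := by
  refine Finset.card_lt_card (Finset.ssubset_iff_of_subset ?_ |>.2 ⟨S, ?_, ?_⟩)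
  · intro T hT
    simp only [Finset.mem_filter] at hT ⊢
    refine ⟨hT.1, fun hvT => ?_⟩
    rcases hF.total hS hT.1 with h | h
    · exact hT.2 (h hu)
    · exact hv (h hvT)
  · simp [hS, hv]
  · simp [hu]

theorem exists_separating_of_chainHeight_lt {F : Finset (Finset V)} {u v : V}
    (h : chainHeight F u < chainHeight F v) : ∃ S ∈ F, u ∈ S ∧ v ∉ S := by
  by_contra! h'
  refine absurd (Finset.card_le_card fun S hS => ?_) (not_le.2 h)
  simp only [Finset.mem_filter] at hS ⊢
  exact ⟨hS.1, fun hu => hS.2 (h' S hS.1 hu)⟩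

/-- An initial segment of an arrangement is determined by its size. -/
theorem mem_iff_lt_card {n : ℕ} (σ : Fin n ≃ V) {S : Finset V}
    (hS : ∀ a b, a ≤ b → σ b ∈ S → σ a ∈ S) (k : Fin n) : σ k ∈ S ↔ (k : ℕ) < S.card := by
  constructor
  · intro hk
    have : (Finset.Iic k).image σ ⊆ S := by
      intro v hv
      obtain ⟨a, ha, rfl⟩ := Finset.mem_image.1 hv
      exact hS a k (Finset.mem_Iic.1 ha) hk
    have := Finset.card_le_card this
    rw [Finset.card_image_of_injective _ σ.injective, Fin.card_Iic] at this
    omega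
  · intro hk
    by_contra hkS
    have : S ⊆ (Finset.Iio k).image σ := by
      intro v hv
      refine Finset.mem_image.2 ⟨σ.symm v, Finset.mem_Iio.2 ?_, σ.apply_symm_apply v⟩
      by_contra h
      exact hkS (hS k _ (not_lt.1 h) (by simpa using hv))
    have := Finset.card_le_card this
    rw [Finset.card_image_of_injective _ σ.injective, Fin.card_Iio] at this
    omega

end ChainHeight

/-! ### Faces of the coloring complex -/

section Coloring

variable {d : ℕ} (G : SimpleGraph (Fin d))

theorem mem_initialLetters {π : Equiv.Perm (Fin d)} {c : ℕ} {a : Fin d} :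
    π a ∈ initialLetters π c ↔ (a : ℕ) < c := by
  simp [initialLetters]

/-- Append `b` to a longest path ending at `a`. The supremum is attained because lengths are bounded
and the one-vertex path exists. -/
theorem pathLength_lt_of_adj {π : Equiv.Perm (Fin d)} {a b : Fin d} (hab : a < b)
    (hadj : G.Adj (π a) (π b)) : pathLength G π a < pathLength G π b := by
  have hbdd : ∀ k : Fin d, BddAbove {n : ℕ | ∃ p : Fin (n + 1) → Fin d, StrictMono p ∧
      p (Fin.last n) = k ∧ ∀ t : Fin n, G.Adj (π (p t.castSucc)) (π (p t.succ))} := by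
    refine fun k => ⟨d, ?_⟩
    rintro n ⟨p, hp, -, -⟩
    have := Fintype.card_le_of_injective p hp.injective
    simp only [Fintype.card_fin] at this
    omega
  have hmem : ∃ p : Fin (pathLength G π a + 1) → Fin d, StrictMono p ∧
      p (Fin.last _) = a ∧ ∀ t : Fin _, G.Adj (π (p t.castSucc)) (π (p t.succ)) :=
    Nat.sSup_mem (s := {n : ℕ | ∃ p : Fin (n + 1) → Fin d, StrictMono p ∧
      p (Fin.last n) = a ∧ ∀ t : Fin n, G.Adj (π (p t.castSucc)) (π (p t.succ))})
      ⟨0, fun _ => a, fun s t h => absurd h (by omega), rfl, fun t => t.elim0⟩ (hbdd a)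
  generalize pathLength G π a = n at hmem
  obtain ⟨p, hp, hpa, hpadj⟩ := hmem
  refine Nat.lt_of_succ_le (le_csSup (hbdd b)
    ⟨(Fin.snoc p b : Fin (n + 1 + 1) → Fin d), ?_, Fin.snoc_last _ _, ?_⟩)
  · refine Fin.strictMono_iff_lt_succ.2 fun t => ?_
    refine Fin.lastCases ?_ (fun t => ?_) t
    · rw [Fin.snoc_castSucc, Fin.succ_last, Fin.snoc_last]
      exact hpa.trans_lt hab
    · rw [Fin.snoc_castSucc, ← Fin.castSucc_succ, Fin.snoc_castSucc]
      exact hp Fin.castSucc_lt_succ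
  · intro t
    refine Fin.lastCases ?_ (fun t => ?_) t
    · rw [Fin.snoc_castSucc, Fin.succ_last, Fin.snoc_last]
      exact hpa.symm ▸ hadj
    · rw [Fin.snoc_castSucc, ← Fin.castSucc_succ, Fin.snoc_castSucc]
      exact hpadj t

/-- Without a cut in between, path length could never rise from `a` to `b`. -/
theorem exists_cut_of_adj {π : Equiv.Perm (Fin d)} {a b : Fin d} (hab : a < b)
    (hadj : G.Adj (π a) (π b)) : ∃ c : ℕ, IsNonzeroCut G π c ∧ (a : ℕ) < c ∧ c ≤ b := by
  by_contra! h
  have key : ∀ m : ℕ, ∀ hm : (a : ℕ) + m ≤ b,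
      pathLength G π ⟨a + m, hm.trans_lt b.2⟩ ≤ pathLength G π a := by
    intro m
    induction m with
    | zero => exact fun _ => le_rfl
    | succ m ih =>
      intro hm
      refine le_trans ?_ (ih (by omega))
      by_contra! hlt
      exact absurd hm (not_le.2 (h (a + (m + 1)) ⟨_, _, rfl, rfl, Or.inl hlt⟩ (by omega)))
  have := key (b - a) (by omega)
  have hb : (⟨a + (b - a), by omega⟩ : Fin d) = b := Fin.ext (by simp; omega)
  rw [hb] at this
  exact absurd (pathLength_lt_of_adj G hab hadj) (not_lt.2 this)

/-- If no edge has its two vertices in the same block of the chain `F`, then some basic coloring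
monomial divides the monomial of `F`. -/
theorem exists_basicColoringSets_subset {F : Finset (Finset (Fin d))}
    (hF : IsChain (· ≤ ·) (F : Set (Finset (Fin d))))
    (hsep : ∀ u v, G.Adj u v → ∃ S ∈ F, ¬ (u ∈ S ↔ v ∈ S)) :
    ∃ π : Equiv.Perm (Fin d), basicColoringSets G π ⊆ (F : Set (Finset (Fin d))) := by
  classical
  let h := chainHeight F
  have hne : ∀ u v, G.Adj u v → h u ≠ h v := by
    intro u v huv
    obtain ⟨S, hS, hS'⟩ := hsep u v huv
    by_cases hu : u ∈ S
    · exact (chainHeight_lt hF hS hu (fun hv => hS' (by simp [hu, hv]))).ne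
    · exact (chainHeight_lt hF hS (by by_contra hv; exact hS' (by simp [hu, hv])) hu).ne'
  -- Path length expressed through the chain alone, so that the permutation can be sorted by it
  -- before its own path lengths are known.
  let len : Fin d → ℕ := fun v => sSup {n : ℕ | ∃ p : Fin (n + 1) → Fin d,
    p (Fin.last n) = v ∧ ∀ t : Fin n, G.Adj (p t.castSucc) (p t.succ) ∧
      h (p t.castSucc) < h (p t.succ)}
  -- Reversing the order in the last two coordinates defeats both cut conditions inside a block.
  let key : Fin d → ℕ ×ₗ ℕᵒᵈ ×ₗ (Fin d)ᵒᵈ := fun v =>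
    toLex (h v, toLex (OrderDual.toDual (len v), OrderDual.toDual v))
  let π : Equiv.Perm (Fin d) := Tuple.sort key
  have hmono : Monotone (key ∘ π) := Tuple.monotone_sort key
  have hh : ∀ a b, a ≤ b → h (π a) ≤ h (π b) := by
    intro a b hab
    have := Prod.Lex.le_iff.1 (hmono hab)
    rcases this with h1 | h1
    · exact le_of_lt h1
    · exact le_of_eq h1.1
  -- Ends of an edge have different heights, so along edges increasing position and increasing
  -- height mean the same.
  have hlen : ∀ k, pathLength G π k = len (π k) := by
    intro k
    unfold pathLength
    simp only [len]
    congr 1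
    ext n
    constructor
    · rintro ⟨p, hp, hpk, hadj⟩
      exact ⟨π ∘ p, congrArg π hpk, fun t => ⟨hadj t,
        lt_of_le_of_ne (hh _ _ (hp Fin.castSucc_lt_succ).le) (hne _ _ (hadj t))⟩⟩
    · rintro ⟨p, hpk, hadj⟩
      refine ⟨π.symm ∘ p, Fin.strictMono_iff_lt_succ.2 fun t => ?_, by simp [hpk], fun t => by
        simpa using (hadj t).1⟩
      by_contra hlt
      have := hh _ _ (not_lt.1 hlt)
      simp only [Function.comp_apply, Equiv.apply_symm_apply] at this
      exact absurd (hadj t).2 (not_lt.2 this)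
  refine ⟨π, ?_⟩
  rintro _ ⟨c, ⟨p, q, hp, hq, hcut⟩, rfl⟩
  have hpq : h (π p) < h (π q) := by
    have hle : p ≤ q := by
      rw [Fin.le_def]
      omega
    rcases Prod.Lex.le_iff.1 (hmono hle) with h1 | ⟨-, h1⟩
    · exact h1
    · exfalso
      rw [hlen, hlen] at hcut
      rcases Prod.Lex.le_iff.1 h1 with h2 | ⟨h2, h3⟩
      · have h2' : len (π q) < len (π p) := h2
        omega
      · have h2' : len (π p) = len (π q) := h2
        have h3' : π q ≤ π p := h3
        rcases hcut with h4 | h4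
        · omega
        · exact absurd h4.2 (not_lt.2 h3')
  obtain ⟨S, hS, hpS, hqS⟩ := exists_separating_of_chainHeight_lt hpq
  have hdown : ∀ a b, a ≤ b → π b ∈ S → π a ∈ S := by
    intro a b hab hb
    by_contra ha
    exact absurd (chainHeight_lt hF hS hb ha) (not_lt.2 (hh a b hab))
  -- `S` is an initial segment of `π` containing `π p` but not the next letter `π q`, hence consists
  -- of the first `c` letters.
  convert Finset.mem_coe.2 hS
  ext v
  obtain ⟨a, rfl⟩ := π.surjective v
  rw [mem_initialLetters]
  constructor
  · intro ha
    refine hdown a p ?_ hpS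
    rw [Fin.le_def]
    omega
  · intro ha
    by_contra hac
    refine hqS (hdown q a ?_ ha)
    rw [Fin.le_def]
    omega

theorem mem_coloringComplex {F : Finset (Finset (Fin d))} : F ∈ coloringComplex G ↔
    F ∈ orderComplex (truncatedBoolean d) ∧ ∃ u v, G.Adj u v ∧ ∀ S ∈ F, (u ∈ S ↔ v ∈ S) := by
  constructor
  · rintro ⟨hF, hπ⟩
    refine ⟨hF, ?_⟩
    by_contra! h
    obtain ⟨π, h⟩ := exists_basicColoringSets_subset G hF.2 fun u v huv => by
      obtain ⟨S, hS, hS'⟩ := h u v huv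
      exact ⟨S, hS, by tauto⟩
    exact hπ π h
  · rintro ⟨hF, u, v, huv, hS⟩
    refine ⟨hF, fun π hπ => ?_⟩
    have key : ∀ a b : Fin d, a < b → G.Adj (π a) (π b) →
        (∀ S ∈ F, (π a ∈ S ↔ π b ∈ S)) → False := by
      intro a b hab hadj h
      obtain ⟨c, hc, hac, hcb⟩ := exists_cut_of_adj G hab hadj
      have := h _ (hπ ⟨c, hc, rfl⟩)
      rw [mem_initialLetters, mem_initialLetters] at this
      omega
    obtain ⟨a, rfl⟩ := π.surjective u
    obtain ⟨b, rfl⟩ := π.surjective v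
    rcases lt_trichotomy a b with h | h | h
    · exact key a b h huv hS
    · exact huv.ne (congrArg π h)
    · exact key b a h huv.symm fun S h => (hS S h).symm

end Coloring

/-! ### Edge-spheres -/

section EdgeSphere

variable {d : ℕ} {e f : Sym2 (Fin d)}

/-- The letter for `e` that stands for the vertex `v`. -/
def edgeLetter (e : Sym2 (Fin d)) (v : Fin d) : EdgeLetter e :=
  if h : v ∈ e then none else some ⟨v, h⟩

theorem mem_edgeLetterSet {x : EdgeLetter e} {v : Fin d} :
    v ∈ edgeLetterSet e x ↔ edgeLetter e v = x := by
  unfold edgeLetter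
  rcases x with _ | w
  · simp [edgeLetterSet]
  · have := w.2
    simp only [edgeLetterSet, Finset.mem_singleton]
    split_ifs with h
    · simp only [iff_false]
      rintro rfl
      exact this h
    · simp [Subtype.ext_iff]

theorem edgeLetter_eq_iff {u v : Fin d} :
    edgeLetter e u = edgeLetter e v ↔ u = v ∨ (u ∈ e ∧ v ∈ e) := by
  unfold edgeLetter
  split_ifs with hu hv hv
  · simp [hu, hv]
  · simp only [hu, hv, and_false, or_false, false_iff]
    rintro rfl
    exact hv hu
  · simp only [hu, hv, false_and, or_false, false_iff]
    rintro rfl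
    exact hu hv
  · simp [hu]

theorem edgeLetter_surjective (e : Sym2 (Fin d)) : Function.Surjective (edgeLetter e) := by
  rintro (_ | v)
  · induction e with
    | _ i j => exact ⟨i, by simp [edgeLetter]⟩
  · exact ⟨v, by simp [edgeLetter, v.2]⟩

theorem card_edgeLetter (he : ¬ e.IsDiag) : Fintype.card (EdgeLetter e) = d - 1 := by
  have h1 : (Finset.univ.filter fun v => v ∉ e) = e.toFinsetᶜ := by
    ext v
    simp
  have h2 := Finset.card_le_univ e.toFinset
  rw [Sym2.card_toFinset_of_not_isDiag e he, Fintype.card_fin] at h2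
  rw [Fintype.card_option, Fintype.card_subtype, h1, Finset.card_compl,
    Sym2.card_toFinset_of_not_isDiag e he, Fintype.card_fin]
  omega

theorem mem_saturatedSets_edgeLetter {i j : Fin d} {S : Finset (Fin d)} :
    S ∈ saturatedSets (edgeLetter s(i, j)) ↔ S ∈ truncatedBoolean d ∧ (i ∈ S ↔ j ∈ S) := by
  refine and_congr_right fun _ => ?_
  simp only [edgeLetter_eq_iff, Sym2.mem_iff]
  constructor
  · intro h
    exact ⟨h i j (by simp), h j i (by simp)⟩
  · rintro h u v (rfl | ⟨rfl | rfl, rfl | rfl⟩) <;> tauto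

theorem mem_edgeChain {σ : EdgePermutation e} {S : Finset (Fin d)} : S ∈ edgeChain e σ ↔
    ∃ m : ℕ, 1 ≤ m ∧ m ≤ d - 2 ∧
      S = Finset.univ.filter fun v => (σ.symm (edgeLetter e v) : ℕ) < m := by
  simp only [edgeChain, Finset.mem_image, Finset.mem_Icc, and_assoc]
  refine exists_congr fun m => and_congr_right fun _ => and_congr_right fun _ => ?_
  rw [eq_comm]
  refine Eq.congr_right ?_
  ext v
  simp only [Finset.mem_biUnion, Finset.mem_filter, Finset.mem_univ, true_and, mem_edgeLetterSet]
  constructor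
  · rintro ⟨k, hk, h⟩
    simpa [h] using hk
  · intro h
    exact ⟨_, h, by simp⟩

theorem filter_lt_injOn (σ : EdgePermutation e) : Set.InjOn
    (fun m : ℕ => Finset.univ.filter fun v => (σ.symm (edgeLetter e v) : ℕ) < m)
    (Finset.Icc 1 (d - 2)) := by
  have key : ∀ m m' : ℕ, m < m' → m' ≤ d - 2 →
      (Finset.univ.filter fun v => (σ.symm (edgeLetter e v) : ℕ) < m) ≠
        Finset.univ.filter fun v => (σ.symm (edgeLetter e v) : ℕ) < m' := by
    intro m m' h hm' heq
    obtain ⟨v, hv⟩ := edgeLetter_surjective e (σ ⟨m, by omega⟩)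
    have := Finset.ext_iff.1 heq v
    simp [hv, h] at this
  intro m hm m' hm' heq
  simp only [Finset.coe_Icc, Set.mem_Icc] at hm hm'
  rcases lt_trichotomy m m' with h | h | h
  · exact absurd heq (key m m' h hm'.2)
  · exact h
  · exact absurd heq.symm (key m' m h hm.2)

theorem edgeChain_eq_image (σ : EdgePermutation e) : edgeChain e σ = (Finset.Icc 1 (d - 2)).image
    fun m : ℕ => Finset.univ.filter fun v => (σ.symm (edgeLetter e v) : ℕ) < m := by
  ext S
  rw [mem_edgeChain]
  simp only [Finset.mem_image, Finset.mem_Icc, and_assoc, eq_comm]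

theorem card_edgeChain (σ : EdgePermutation e) : (edgeChain e σ).card = d - 2 := by
  rw [edgeChain_eq_image, Finset.card_image_of_injOn (filter_lt_injOn σ), Nat.card_Icc]
  omega

/-- If the letter of `v` has zero-based position `p`, then `v` is missing exactly from `S_1, …,
S_p`. Thus the chain determines the arrangement. -/
theorem chainHeight_edgeChain (σ : EdgePermutation e) (v : Fin d) :
    chainHeight (edgeChain e σ) v = σ.symm (edgeLetter e v) := by
  rw [chainHeight, edgeChain_eq_image, Finset.filter_image, Finset.card_image_of_injOn
    ((filter_lt_injOn σ).mono (Finset.coe_subset.2 (Finset.filter_subset _ _)))]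
  have : ((Finset.Icc 1 (d - 2)).filter fun m : ℕ =>
      v ∉ Finset.univ.filter fun v => (σ.symm (edgeLetter e v) : ℕ) < m) =
      Finset.Icc 1 (σ.symm (edgeLetter e v) : ℕ) := by
    ext m
    have := (σ.symm (edgeLetter e v)).2
    simp only [Finset.mem_filter, Finset.mem_Icc, Finset.mem_univ, true_and, not_lt]
    omega
  rw [this, Nat.card_Icc]
  omega

theorem edgeChain_injective (e : Sym2 (Fin d)) : Function.Injective (edgeChain e) := by
  intro σ τ h
  have : σ.symm = τ.symm := by
    ext x
    obtain ⟨v, rfl⟩ := edgeLetter_surjective e x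
    rw [← chainHeight_edgeChain, h, chainHeight_edgeChain]
  rw [← σ.symm_symm, this, τ.symm_symm]

theorem ncard_edgeFacets (he : ¬ e.IsDiag) : (edgeFacets e).ncard = (d - 1).factorial := by
  rw [edgeFacets, Set.ncard_range_of_injective (edgeChain_injective e), Nat.card_eq_fintype_card,
    Fintype.card_equiv (Fintype.equivFinOfCardEq (card_edgeLetter he)).symm, Fintype.card_fin]

theorem edgeChain_mem_orderComplex (σ : EdgePermutation e) :
    edgeChain e σ ∈ orderComplex (saturatedSets (edgeLetter e)) := by
  constructor
  · intro S hS
    obtain ⟨m, hm1, hm2, rfl⟩ := mem_edgeChain.1 hS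
    obtain ⟨u, hu⟩ := edgeLetter_surjective e (σ ⟨0, by omega⟩)
    obtain ⟨w, hw⟩ := edgeLetter_surjective e (σ ⟨d - 2, by omega⟩)
    refine ⟨⟨?_, ?_⟩, fun u v huv hu => by simpa [← huv] using hu⟩
    · refine Finset.ne_empty_of_mem (a := u) ?_
      simp only [Finset.mem_filter, Finset.mem_univ, true_and, hu, Equiv.symm_apply_apply]
      exact hm1
    · intro h
      have := Finset.mem_univ w
      rw [← h] at this
      simp only [Finset.mem_filter, hw, Equiv.symm_apply_apply] at this
      omega
  · intro S hS T hT _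
    obtain ⟨m, -, -, rfl⟩ := mem_edgeChain.1 hS
    obtain ⟨m', -, -, rfl⟩ := mem_edgeChain.1 hT
    rcases le_total m m' with h | h
    · exact Or.inl (Finset.monotone_filter_right _ fun v _ hv => hv.trans_le h)
    · exact Or.inr (Finset.monotone_filter_right _ fun v _ hv => hv.trans_le h)

/-- Sort the letters by the height of a representative vertex. Each set of `F` is then an initial
segment of letters, and `m` is the number of letters it contains. -/
theorem exists_subset_edgeChain (he : ¬ e.IsDiag) {F : Finset (Finset (Fin d))}
    (hF : F ∈ orderComplex (saturatedSets (edgeLetter e))) : ∃ σ, F ⊆ edgeChain e σ := by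
  obtain ⟨hP, hc⟩ := hF
  obtain ⟨s, hs⟩ := (edgeLetter_surjective e).hasRightInverse
  let ε : EdgePermutation e := (Fintype.equivFinOfCardEq (card_edgeLetter he)).symm
  let key : Fin (d - 1) → ℕ := fun k => chainHeight F (s (ε k))
  let σ : EdgePermutation e := (Tuple.sort key).trans ε
  have hmono : ∀ a b, a ≤ b → chainHeight F (s (σ a)) ≤ chainHeight F (s (σ b)) :=
    fun a b hab => Tuple.monotone_sort key hab
  refine ⟨σ, fun S hS => ?_⟩
  obtain ⟨⟨hS1, hS2⟩, hS3⟩ := hP hS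
  have himg : ∀ v, edgeLetter e v ∈ S.image (edgeLetter e) ↔ v ∈ S := by
    intro v
    rw [Finset.mem_image]
    exact ⟨fun ⟨u, hu, huv⟩ => hS3 u v huv hu, fun h => ⟨v, h, rfl⟩⟩
  have himg' : ∀ x, x ∈ S.image (edgeLetter e) ↔ s x ∈ S := fun x => by
    rw [← himg (s x), hs x]
  have hlt := mem_iff_lt_card σ (S := S.image (edgeLetter e)) (by
    intro a b hab hb
    rw [himg'] at hb ⊢
    by_contra ha
    exact absurd (chainHeight_lt hc hS hb ha) (not_lt.2 (hmono a b hab)))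
  refine mem_edgeChain.2 ⟨(S.image (edgeLetter e)).card, ?_, ?_, ?_⟩
  · exact Finset.card_pos.2 ((Finset.nonempty_iff_ne_empty.2 hS1).image _)
  · have : S.image (edgeLetter e) ⊂ Finset.univ := by
      refine Finset.ssubset_univ_iff.2 fun h => hS2 ?_
      ext v
      simp [← himg v, h]
    have := Finset.card_lt_card this
    rw [Finset.card_univ, card_edgeLetter he] at this
    omega
  · ext v
    simp only [Finset.mem_filter, Finset.mem_univ, true_and, ← hlt, Equiv.apply_symm_apply, himg]

theorem edgeSphere_eq (he : ¬ e.IsDiag) :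
    edgeSphere e = orderComplex (saturatedSets (edgeLetter e)) := by
  ext F
  constructor
  · rintro ⟨_, ⟨σ, rfl⟩, h⟩
    exact (orderComplex _).lower h (edgeChain_mem_orderComplex σ)
  · intro hF
    obtain ⟨σ, h⟩ := exists_subset_edgeChain he hF
    exact ⟨_, ⟨σ, rfl⟩, h⟩

theorem orderComplex_inf {α : Type*} [LE α] (P Q : Set α) :
    orderComplex P ⊓ orderComplex Q = orderComplex (P ∩ Q) := by
  ext F
  constructor
  · rintro ⟨h1, h2⟩
    exact ⟨Set.subset_inter h1.1 h2.1, h1.2⟩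
  · rintro ⟨h1, h2⟩
    exact ⟨⟨h1.trans Set.inter_subset_left, h2⟩, ⟨h1.trans Set.inter_subset_right, h2⟩⟩

/-! ### Contracting one or two edges -/

theorem exists_collapse (he : ¬ e.IsDiag) : ∃ q : Fin d → Fin (d - 1), Function.Surjective q ∧
    ∀ u v, q u = q v ↔ edgeLetter e u = edgeLetter e v :=
  let ε := Fintype.equivFinOfCardEq (card_edgeLetter he)
  ⟨ε ∘ edgeLetter e, ε.surjective.comp (edgeLetter_surjective e), fun _ _ => ε.injective.eq_iff⟩

/-- Contract `e`, then the image of `f`. That image is not a loop because `e ≠ f`; whether the edges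
share a vertex does not matter. -/
theorem exists_collapse_two (he : ¬ e.IsDiag) (hf : ¬ f.IsDiag) (hef : e ≠ f) :
    ∃ q : Fin d → Fin (d - 2), Function.Surjective q ∧
      saturatedSets q = saturatedSets (edgeLetter e) ∩ saturatedSets (edgeLetter f) := by
  obtain ⟨q₁, hq₁, hk₁⟩ := exists_collapse he
  induction f with
  | _ i j =>
    have hij : i ≠ j := hf
    have hij₁ : q₁ i ≠ q₁ j := by
      rw [Ne, hk₁, edgeLetter_eq_iff]
      rintro (h | h)
      · exact hij h
      · exact hef ((Sym2.mem_and_mem_iff hij).1 h)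
    obtain ⟨q₂, hq₂, hk₂⟩ := exists_collapse (e := s(q₁ i, q₁ j)) hij₁
    refine ⟨q₂ ∘ q₁, hq₂.comp hq₁, ?_⟩
    ext S
    rw [Set.mem_inter_iff, mem_saturatedSets_edgeLetter]
    constructor
    · rintro ⟨hS, h⟩
      refine ⟨⟨hS, fun u v huv => h u v (congrArg q₂ ((hk₁ u v).2 huv))⟩, hS, ?_⟩
      have : q₂ (q₁ i) = q₂ (q₁ j) := (hk₂ _ _).2 (edgeLetter_eq_iff.2 (Or.inr (by simp)))
      exact ⟨h i j this, h j i this.symm⟩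
    · rintro ⟨⟨hS, h⟩, -, h'⟩
      have h₁ : ∀ u v, q₁ u = q₁ v → (u ∈ S ↔ v ∈ S) := fun u v huv =>
        ⟨h u v ((hk₁ u v).1 huv), h v u ((hk₁ v u).1 huv.symm)⟩
      refine ⟨hS, fun u v huv => ?_⟩
      rcases edgeLetter_eq_iff.1 ((hk₂ _ _).1 huv) with h2 | ⟨hu, hv⟩
      · exact (h₁ u v h2).1
      · have key : ∀ w, q₁ w ∈ s(q₁ i, q₁ j) → (w ∈ S ↔ i ∈ S) := by
          intro w hw
          rcases Sym2.mem_iff.1 hw with hw | hw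
          · exact h₁ w i hw
          · exact (h₁ w j hw).trans h'.symm
        exact ((key u hu).trans (key v hv).symm).1

theorem saturatedSets_congr {α β : Type*} {q : Fin d → α} {q' : Fin d → β}
    (h : ∀ u v, q u = q v ↔ q' u = q' v) : saturatedSets q = saturatedSets q' := by
  ext S
  simp only [saturatedSets, h]

theorem barycentricSubdivision_simplexBoundary (n : ℕ) :
    barycentricSubdivision (simplexBoundary n) = orderComplex (truncatedBoolean n) := by
  have : {F : Finset (Fin n) | F ∈ simplexBoundary n ∧ F ≠ ∅} = truncatedBoolean n := by
    ext F
    exact and_comm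
  rw [barycentricSubdivision, this]

/-! ### Facets and dimension of the coloring complex -/

theorem edgeChain_mem_coloringComplex {G : SimpleGraph (Fin d)} (he : e ∈ G.edgeSet)
    (σ : EdgePermutation e) : edgeChain e σ ∈ coloringComplex G := by
  have h := edgeChain_mem_orderComplex σ
  induction e with
  | _ i j =>
    exact (mem_coloringComplex G).2 ⟨⟨fun S hS => (h.1 hS).1, h.2⟩, i, j, he,
      fun S hS => (mem_saturatedSets_edgeLetter.1 (h.1 hS)).2⟩

theorem exists_subset_edgeChain_of_mem_coloringComplex {G : SimpleGraph (Fin d)}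
    {F : Finset (Finset (Fin d))} (hF : F ∈ coloringComplex G) :
    ∃ e ∈ G.edgeSet, ∃ σ, F ⊆ edgeChain e σ := by
  obtain ⟨⟨h1, h2⟩, u, v, huv, h⟩ := (mem_coloringComplex G).1 hF
  refine ⟨s(u, v), huv, exists_subset_edgeChain (e := s(u, v)) huv.ne
    ⟨fun S hS => mem_saturatedSets_edgeLetter.2 ⟨h1 hS, h S hS⟩, h2⟩⟩

/-- Every face lies in an edge chain, and all edge chains have `d - 2` sets, so none properly
contains another. -/
theorem complexFacets_coloringComplex (G : SimpleGraph (Fin d)) :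
    complexFacets (coloringComplex G) = ⋃ e ∈ G.edgeSet, edgeFacets e := by
  ext F
  simp only [Set.mem_iUnion, exists_prop]
  constructor
  · intro hF
    obtain ⟨e, he, σ, h⟩ := exists_subset_edgeChain_of_mem_coloringComplex hF.prop
    exact ⟨e, he, σ, (hF.eq_of_le (edgeChain_mem_coloringComplex he σ) h).symm⟩
  · rintro ⟨e, he, σ, rfl⟩
    refine ⟨edgeChain_mem_coloringComplex he σ, fun F' hF' hle => ?_⟩
    obtain ⟨e', he', σ', h⟩ := exists_subset_edgeChain_of_mem_coloringComplex hF'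
    refine (Finset.eq_of_subset_of_card_le hle ?_).ge
    rw [card_edgeChain, ← card_edgeChain σ']
    exact Finset.card_le_card h

/-- A chain of proper nonempty saturated sets has fewer elements than there are fibres. -/
theorem card_lt_of_mem_orderComplex_saturatedSets {k : ℕ} (hk : 0 < k) {q : Fin d → Fin k}
    {F : Finset (Finset (Fin d))} (hF : F ∈ orderComplex (saturatedSets q)) : F.card < k := by
  -- Saturated sets are determined by their images, so image sizes embed the chain into the integers
  -- strictly between `0` and `k`.
  have hlt : ∀ S ∈ F, ∀ T ∈ F, S ⊂ T → (S.image q).card < (T.image q).card := by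
    intro S hS T hT hST
    obtain ⟨v, hvT, hvS⟩ := Finset.exists_of_ssubset hST
    refine Finset.card_lt_card ((Finset.ssubset_iff_of_subset
      (Finset.image_subset_image hST.subset)).2 ⟨q v, Finset.mem_image_of_mem q hvT, ?_⟩)
    intro h
    obtain ⟨u, hu, huv⟩ := Finset.mem_image.1 h
    exact hvS ((hF.1 hS).2 u v huv hu)
  have hmaps : ∀ S ∈ F, (S.image q).card ∈ Finset.Ioo 0 k := by
    intro S hS
    obtain ⟨⟨h1, h2⟩, h3⟩ := hF.1 hS
    refine Finset.mem_Ioo.2 ⟨Finset.card_pos.2 ((Finset.nonempty_iff_ne_empty.2 h1).image q), ?_⟩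
    by_contra hle
    have huniv : S.image q = Finset.univ := (Finset.card_eq_iff_eq_univ _).1
      (le_antisymm (Finset.card_le_univ _) (by simpa using hle))
    apply h2
    ext v
    have := Finset.mem_univ (q v)
    rw [← huniv] at this
    obtain ⟨u, hu, huv⟩ := Finset.mem_image.1 this
    simpa using h3 u v huv hu
  have := Finset.card_le_card_of_injOn _ hmaps (by
    intro S hS T hT heq
    by_contra hne
    rcases hF.2.total hS hT with h | h
    · exact (hlt S hS T hT (lt_of_le_of_ne h hne)).ne heq
    · exact (hlt T hT S hS (lt_of_le_of_ne h (Ne.symm hne))).ne heq.symm)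
  rw [Nat.card_Ioo] at this
  omega

/-- A common facet would be a chain of `d - 2` sets saturated for a map onto `d - 2` points, one
more than possible. -/
theorem disjoint_edgeFacets (hd : 3 ≤ d) (he : ¬ e.IsDiag) (hf : ¬ f.IsDiag) (hef : e ≠ f) :
    Disjoint (edgeFacets e) (edgeFacets f) := by
  rw [Set.disjoint_left]
  rintro _ ⟨σ, rfl⟩ ⟨τ, hτ⟩
  obtain ⟨q, -, hq⟩ := exists_collapse_two he hf hef
  have hmem : edgeChain e σ ∈ orderComplex (saturatedSets q) := by
    rw [hq, ← orderComplex_inf]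
    refine ⟨edgeChain_mem_orderComplex σ, ?_⟩
    rw [← hτ]
    exact edgeChain_mem_orderComplex τ
  have := card_lt_of_mem_orderComplex_saturatedSets (by omega) hmem
  rw [card_edgeChain] at this
  exact this.false

theorem hasComplexDim_coloringComplex (hd : 3 ≤ d) {G : SimpleGraph (Fin d)} (hG : G ≠ ⊥) :
    HasComplexDim (coloringComplex G) ((d : ℤ) - 3) := by
  obtain ⟨e, he⟩ := SimpleGraph.edgeSet_nonempty.2 hG
  constructor
  · let σ : EdgePermutation e := (Fintype.equivFinOfCardEq
      (card_edgeLetter (G.not_isDiag_of_mem_edgeSet he))).symm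
    refine ⟨_, edgeChain_mem_coloringComplex he σ, ?_⟩
    rw [card_edgeChain]
    omega
  · rintro _ ⟨F, hF, rfl⟩
    obtain ⟨e', -, σ, h⟩ := exists_subset_edgeChain_of_mem_coloringComplex hF
    have := Finset.card_le_card h
    rw [card_edgeChain] at this
    omega

/-- Even the empty face requires an unseparated edge. -/
theorem coloringComplex_bot : coloringComplex (⊥ : SimpleGraph (Fin d)) = ⊥ := by
  ext F
  simp only [SetLike.mem_coe, LowerSet.coe_bot, Set.mem_empty_iff_false, iff_false]
  intro hF
  obtain ⟨e, he, -⟩ := exists_subset_edgeChain_of_mem_coloringComplex hF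
  simp at he

theorem isComplexSphere_of_surjective {k m : ℕ} (hk : 0 < k) (hm : m = k - 1) {q : Fin d → Fin k}
    (hq : Function.Surjective q) : IsComplexSphere (orderComplex (saturatedSets q)) m := by
  obtain ⟨k, rfl⟩ := Nat.exists_eq_succ_of_ne_zero hk.ne'
  subst hm
  exact isComplexSphere_saturatedSets hq

/-- Since `e ≠ s(i, j)`, contracting `e` keeps `i` and `j` apart, as the general separation result
requires. -/
theorem separatesComplex_edgeSphere (he : ¬ e.IsDiag) {i j : Fin d} (hij : i ≠ j)
    (hef : e ≠ s(i, j)) :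
    SeparatesComplex (edgeSphere e) (edgeSphere e ⊓ edgeSphere s(i, j))
      {S | i ∈ S ∧ j ∉ S} {S | j ∈ S ∧ i ∉ S} := by
  have h : saturatedSets (edgeLetter e) ∩ saturatedSets (edgeLetter s(i, j)) =
      saturatedSets (edgeLetter e) ∩ {S | i ∈ S ↔ j ∈ S} := by
    ext S
    rw [Set.mem_inter_iff, mem_saturatedSets_edgeLetter]
    exact and_congr_right fun h => and_iff_right h.1
  rw [edgeSphere_eq he, edgeSphere_eq (e := s(i, j)) hij, orderComplex_inf, h]
  refine separatesComplex_saturatedSets fun h => ?_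
  rcases edgeLetter_eq_iff.1 h with h | h
  · exact hij h
  · exact hef ((Sym2.mem_and_mem_iff hij).1 h)

end EdgeSphere

theorem mainTheorem5 (d : ℕ) (hd : 3 ≤ d) (G : SimpleGraph (Fin d)) :
    -- the facets: `(d - 1)!` for each edge, disjoint for distinct edges, and no others
    (∀ e ∈ G.edgeSet, Function.Injective (edgeChain e) ∧
      (edgeFacets e).ncard = (d - 1).factorial) ∧
    complexFacets (coloringComplex G) = ⋃ e ∈ G.edgeSet, edgeFacets e ∧
    (∀ e ∈ G.edgeSet, ∀ f ∈ G.edgeSet, e ≠ f → Disjoint (edgeFacets e) (edgeFacets f)) ∧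
    -- the edge-spheres
    (∀ e ∈ G.edgeSet,
      IsComplexSphere (edgeSphere e) (d - 2) ∧
      ComplexIso (edgeSphere e) (orderComplex (truncatedBoolean (d - 1))) ∧
      ComplexIso (edgeSphere e) (barycentricSubdivision (simplexBoundary (d - 1)))) ∧
    -- the dimension
    (G ≠ ⊥ → HasComplexDim (coloringComplex G) ((d : ℤ) - 3)) ∧
    (G = ⊥ → coloringComplex G = ⊥) ∧
    -- the intersections of two edge-spheres
    (∀ e ∈ G.edgeSet, ∀ f ∈ G.edgeSet, e ≠ f →
      IsComplexSphere (edgeSphere e ⊓ edgeSphere f) (d - 3) ∧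
      ComplexIso (edgeSphere e ⊓ edgeSphere f) (orderComplex (truncatedBoolean (d - 2))) ∧
      ∀ i j : Fin d, f = s(i, j) →
        SeparatesComplex (edgeSphere e) (edgeSphere e ⊓ edgeSphere f)
          {S | i ∈ S ∧ j ∉ S} {S | j ∈ S ∧ i ∉ S}) := by
  have hdiag : ∀ e ∈ G.edgeSet, ¬ e.IsDiag := fun e he => G.not_isDiag_of_mem_edgeSet he
  refine ⟨fun e he => ⟨edgeChain_injective e, ncard_edgeFacets (hdiag e he)⟩,
    complexFacets_coloringComplex G,
    fun e he f hf hef => disjoint_edgeFacets hd (hdiag e he) (hdiag f hf) hef, fun e he => ?_,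
    hasComplexDim_coloringComplex hd, fun hG => hG ▸ coloringComplex_bot,
    fun e he f hf hef => ?_⟩
  · obtain ⟨q, hq, hk⟩ := exists_collapse (hdiag e he)
    rw [edgeSphere_eq (hdiag e he), ← saturatedSets_congr hk,
      barycentricSubdivision_simplexBoundary]
    exact ⟨isComplexSphere_of_surjective (by omega) (by omega) hq, complexIso_saturatedSets hq,
      complexIso_saturatedSets hq⟩
  · refine ⟨?_, ?_, ?_⟩
    rotate_left 2
    · rintro i j rfl
      exact separatesComplex_edgeSphere (hdiag e he) (hdiag _ hf) hef
    all_goals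
      obtain ⟨q, hq, hk⟩ := exists_collapse_two (hdiag e he) (hdiag f hf) hef
      rw [edgeSphere_eq (hdiag e he), edgeSphere_eq (hdiag f hf), orderComplex_inf, ← hk]
    · exact isComplexSphere_of_surjective (by omega) (by omega) hq
    · exact complexIso_saturatedSets hq
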